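/- Let $n,m\in\mathbb N$. A (feedforward) ReLU network $N:\mathbb R^n\to\mathbb R^m$ is a layered network with rational weights and biases whose hidden nodes compute $\max(0,\cdot)$ of an affine combination of the outputs of the previous layer, and whose output nodes compute an affine combination of the outputs of the last hidden layer (or of the inputs, if there is no hidden layer). A rule $\varphi\Rightarrow\psi$ consists of a conditional part $\varphi$, the indicator function of a set $S_\varphi\subseteq\mathbb R^n$, and a conclusion part $\psi$, the indicator function of a set $S_\psi\subseteq\mathbb R^m$. A network $N$ obeys the rule if $N(x)\in S_\psi$ for all $x\in S_\varphi$. All intervals and half-spaces below have rational data. The rule is called - propositional, if $S_\varphi$ and $S_\psi$ are Boolean combinations of sets $\{x : x_i\in I\}$, where $I$ is an interval (open, closed or half-open) with endpoints in $\mathbb Q\cup\{\pm\infty\}$; - oblique, if $S_\varphi$ and $S_\psi$ are Boolean combinations of half-spaces $\{x : a\cdot x\le b\}$, where $a\neq 0$ is a rational vector and $b\in\mathbb Q$; - MofN, if $S_\psi$ is a Boolean combination of such half-spaces and there are $\square\in\{\le,=,\ge\}$, $t,r\in\mathbb N$ and Boolean combinations $A_1,\dots,A_t\subseteq\mathbb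 R^n$ of such half-spaces with $S_\varphi=\{x : |\{i : x\in A_i\}|\mathrel{\square} r\}$. **Theorem.** Let $S$ be a finite set of rules for networks $\mathbb R^n\to\mathbb R^m$, each of which is propositional, MofN or oblique. Suppose that for any two distinct rules $\varphi\Rightarrow\psi$ and $\varphi'\Rightarrow\psi'$ in $S$ the sets $S_\varphi$ and $S_{\varphi'}$ are separated by closed neighbourhoods, i.e. there are disjoint closed sets $U,V$ with $S_\varphi\subseteq\operatorname{int}U$ and $S_{\varphi'}\subseteq\operatorname{int}V$, and that no conclusion part is identically false, i.e. $S_\psi\neq\emptyset$ for every rule in $S$. Then there exists a ReLU network that obeys all rules in $S$. -/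

import Mathlib

open Set Topology

/-- A layered feedforward neural network with `n` input nodes and `m` output nodes. The weights
`W i j` (from node `j` of the previous layer to node `i`) and the biases `b i` are rational, and
every computation node `i` has its own activation function `σ i`. A network is either a single
output layer on top of its inputs, or a hidden layer with `k` nodes followed by a network that
takes the outputs of this hidden layer as its inputs. -/
inductive FeedforwardNet : ℕ → ℕ → Type
  | output {n m : ℕ} (W : Matrix (Fin m) (Fin n) ℚ) (b : Fin m → ℚ) (σ : Fin m → ℝ → ℝ) :
      FeedforwardNet n m
  | hidden {n k m : ℕ} (W : Matrix (Fin k) (Fin n) ℚ) (b : Fin k → ℚ) (σ : Fin k → ℝ → ℝ)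
      (N : FeedforwardNet k m) : FeedforwardNet n m

/-- The outputs `σ i (∑ j, W i j * x j + b i)` of the nodes of one layer. -/
noncomputable def layerOutput {n k : ℕ} (W : Matrix (Fin k) (Fin n) ℚ) (b : Fin k → ℚ)
    (σ : Fin k → ℝ → ℝ) (x : Fin n → ℝ) : Fin k → ℝ :=
  fun i => σ i (∑ j, (W i j : ℝ) * x j + (b i : ℝ))

/-- The function `ℝⁿ → ℝᵐ` computed by a network. -/
noncomputable def FeedforwardNet.eval : {n m : ℕ} → FeedforwardNet n m → (Fin n → ℝ) → Fin m → ℝ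
  | _, _, .output W b σ, x => layerOutput W b σ x
  | _, _, .hidden W b σ N, x => N.eval (layerOutput W b σ x)

/-- The rectified linear unit. -/
noncomputable def relu (t : ℝ) : ℝ := max 0 t

/-- A ReLU network: all hidden nodes use the activation ReLU, and the output nodes are linear
(their activation is the identity). -/
def FeedforwardNet.IsReLU : {n m : ℕ} → FeedforwardNet n m → Prop
  | _, _, .output _ _ σ => ∀ i, σ i = id
  | _, _, .hidden _ _ σ N => (∀ i, σ i = relu) ∧ N.IsReLU

/-- Intervals of the real line with endpoints in `ℚ ∪ {-∞, ∞}`. -/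
inductive IsRatInterval : Set ℝ → Prop
  | icc (a b : ℚ) : IsRatInterval (Icc (a : ℝ) (b : ℝ))
  | ico (a b : ℚ) : IsRatInterval (Ico (a : ℝ) (b : ℝ))
  | ioc (a b : ℚ) : IsRatInterval (Ioc (a : ℝ) (b : ℝ))
  | ioo (a b : ℚ) : IsRatInterval (Ioo (a : ℝ) (b : ℝ))
  | ici (a : ℚ) : IsRatInterval (Ici (a : ℝ))
  | ioi (a : ℚ) : IsRatInterval (Ioi (a : ℝ))
  | iic (b : ℚ) : IsRatInterval (Iic (b : ℝ))
  | iio (b : ℚ) : IsRatInterval (Iio (b : ℝ))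
  | univ : IsRatInterval Set.univ

/-- The sets `{x | x i ∈ I}` given by a paraxial condition with rational data. -/
def paraxialSets (n : ℕ) : Set (Set (Fin n → ℝ)) :=
  {A | ∃ (i : Fin n) (I : Set ℝ), IsRatInterval I ∧ A = {x | x i ∈ I}}

/-- The closed half-spaces `{x | ∑ i, a i * x i ≤ b}` with rational data and `a ≠ 0`. The open
half-spaces are the complements of closed ones. -/
def halfSpaces (n : ℕ) : Set (Set (Fin n → ℝ)) :=
  {A | ∃ (a : Fin n → ℚ) (b : ℚ), a ≠ 0 ∧ A = {x | ∑ i, (a i : ℝ) * x i ≤ (b : ℝ)}}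

/-- Boolean combinations of paraxial conditions. -/
def IsParaxialCombination {n : ℕ} (A : Set (Fin n → ℝ)) : Prop :=
  A ∈ BooleanSubalgebra.closure (paraxialSets n)

/-- Boolean combinations of half-spaces. -/
def IsHalfSpaceCombination {n : ℕ} (A : Set (Fin n → ℝ)) : Prop :=
  A ∈ BooleanSubalgebra.closure (halfSpaces n)

/-- A rule `φ ⇒ ψ` for networks `ℝⁿ → ℝᵐ`. The indicator functions `φ` (the conditional part) and
`ψ` (the conclusion part) are given by the sets of points where they hold. -/
@[ext]
structure Rule (n m : ℕ) where
  cond : Set (Fin n → ℝ)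
  concl : Set (Fin m → ℝ)

/-- The network `N` obeys the rule `φ ⇒ ψ`, that is, `φ x` implies `ψ (N x)` for all inputs. -/
def FeedforwardNet.Obeys {n m : ℕ} (N : FeedforwardNet n m) (s : Rule n m) : Prop :=
  ∀ x, x ∈ s.cond → N.eval x ∈ s.concl

/-- Propositional rules. -/
def Rule.IsPropositional {n m : ℕ} (s : Rule n m) : Prop :=
  IsParaxialCombination s.cond ∧ IsParaxialCombination s.concl

/-- Oblique rules. -/
def Rule.IsOblique {n m : ℕ} (s : Rule n m) : Prop :=
  IsHalfSpaceCombination s.cond ∧ IsHalfSpaceCombination s.concl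

/-- `MofN` rules: `x` satisfies the conditional part iff the number of `i` with `x ∈ A i` is at
most, exactly, or at least `r`. -/
def Rule.IsMofN {n m : ℕ} (s : Rule n m) : Prop :=
  (∃ (t r : ℕ) (A : Fin t → Set (Fin n → ℝ)), (∀ i, IsHalfSpaceCombination (A i)) ∧
    (s.cond = {x | {i | x ∈ A i}.ncard ≤ r} ∨
      s.cond = {x | {i | x ∈ A i}.ncard = r} ∨
      s.cond = {x | r ≤ {i | x ∈ A i}.ncard})) ∧
  IsHalfSpaceCombination s.concl

/-- Two sets are separated by closed neighbourhoods if they have disjoint closed neighbourhoods. -/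
def SeparatedByClosedNhds {X : Type*} [TopologicalSpace X] (A B : Set X) : Prop :=
  ∃ U V : Set X, IsClosed U ∧ IsClosed V ∧ U ∈ 𝓝ˢ A ∧ V ∈ 𝓝ˢ B ∧ Disjoint U V

/-! All conditional parts are unions of cells of one finite arrangement of rational hyperplanes, and
separation makes their closures disjoint. If a cell meets `A`, its weak version lies in `closure A`
(`DeterminedBy.weakCell_subset_closure`), so weak cells met by different conditional parts are
disjoint polyhedra. By Motzkin transposition the total violation of one such polyhedron's
inequalities is at least `1 / K` on the other. Hence `relu (1 - K * violation)` is 1 on a weak cell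
and 0 on the disjoint ones. Adding these bumps over the cells that meet a conditional part and
clamping gives an exact indicator on all conditional parts.

A linear output layer then assigns to each conditional part a point of its conclusion. Biases and
weights are rational, so that point must be rational; it exists because a rational linear system
solvable over `ℝ` is solvable over `ℚ`. -/

/-! ### Rational linear inequalities: elimination and infeasibility certificates. -/

/-- A rational linear constraint `a · x ≤ b`, or `a · x < b` if it is strict. -/
structure RatConstraint (n : ℕ) where
  a : Fin n → ℚ
  b : ℚ
  strict : Prop

/-- The point `x` over an ordered field satisfies the constraint `c`. -/
def RatConstraint.Sat {n : ℕ} {R : Type*} [Field R] [LinearOrder R] (c : RatConstraint n)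
    (x : Fin n → R) : Prop :=
  ∑ i, (c.a i : R) * x i ≤ c.b ∧ (c.strict → ∑ i, (c.a i : R) * x i < c.b)

/-- The constraints that are positive combinations of constraints in `S`. -/
inductive RatConstraint.Derives {n : ℕ} (S : Set (RatConstraint n)) :
    (Fin n → ℚ) → ℚ → Prop → Prop
  | mem {c : RatConstraint n} (h : c ∈ S) : Derives S c.a c.b c.strict
  | add {a a' : Fin n → ℚ} {b b' : ℚ} {s s' : Prop} (h : Derives S a b s)
      (h' : Derives S a' b' s') : Derives S (a + a') (b + b') (s ∨ s')
  | smul {a : Fin n → ℚ} {b : ℚ} {s : Prop} (r : ℚ) (hr : 0 < r) (h : Derives S a b s) :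
      Derives S (r • a) (r * b) s

namespace RatConstraint

/-- The one-variable case of elimination: only the largest lower and the smallest upper bound
matter. -/
theorem exists_between_bounds {ι : Type*} {L U : Set ι} (hL : L.Finite) (hU : U.Finite)
    (v : ι → ℚ) (s : ι → Prop)
    (h : ∀ i ∈ L, ∀ j ∈ U, v i ≤ v j ∧ (s i ∨ s j → v i < v j)) :
    ∃ t, (∀ i ∈ L, v i ≤ t ∧ (s i → v i < t)) ∧ ∀ j ∈ U, t ≤ v j ∧ (s j → t < v j) := by
  rcases L.eq_empty_or_nonempty with rfl | hLn
  · rcases U.eq_empty_or_nonempty with rfl | hUn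
    · exact ⟨0, by simp, by simp⟩
    · obtain ⟨j, -, hj⟩ := exists_min_image U v hU hUn
      refine ⟨v j - 1, by simp, fun k hk => ?_⟩
      have := hj k hk
      exact ⟨by linarith, fun _ => by linarith⟩
  obtain ⟨i, hi, himax⟩ := exists_max_image L v hL hLn
  rcases U.eq_empty_or_nonempty with rfl | hUn
  · refine ⟨v i + 1, fun k hk => ?_, by simp⟩
    have := himax k hk
    exact ⟨by linarith, fun _ => by linarith⟩
  obtain ⟨j, hj, hjmin⟩ := exists_min_image U v hU hUn
  rcases (h i hi j hj).1.lt_or_eq with hlt | heq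
  · refine ⟨(v i + v j) / 2, fun k hk => ?_, fun k hk => ?_⟩
    · have := himax k hk
      exact ⟨by linarith, fun _ => by linarith⟩
    · have := hjmin k hk
      exact ⟨by linarith, fun _ => by linarith⟩
  -- When the extreme bounds coincide, their common value is the only choice; `h` rules out that a
  -- strict bound attains it.
  · exact ⟨v i, fun k hk => ⟨himax k hk, fun hs => heq ▸ (h k hk j hj).2 (.inl hs)⟩,
      fun k hk => ⟨heq ▸ hjmin k hk, fun hs => (h i hi k hk).2 (.inr hs)⟩⟩

/-- Forget the first coefficient. -/
def tail {n : ℕ} (c : RatConstraint (n + 1)) : RatConstraint n :=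
  ⟨fun i => c.a i.succ, c.b, c.strict⟩

/-- The combination of an upper bound `c` and a lower bound `d` for the first variable that
eliminates this variable. -/
def eliminate {n : ℕ} (c d : RatConstraint (n + 1)) : RatConstraint n :=
  ⟨fun i => (c.a 0)⁻¹ * c.a i.succ + (-d.a 0)⁻¹ * d.a i.succ,
    (c.a 0)⁻¹ * c.b + (-d.a 0)⁻¹ * d.b, c.strict ∨ d.strict⟩

/-- Fourier–Motzkin elimination of the first variable. -/
def eliminateAll {n : ℕ} (S : Set (RatConstraint (n + 1))) : Set (RatConstraint n) :=
  tail '' {c ∈ S | c.a 0 = 0} ∪ image2 eliminate {c ∈ S | 0 < c.a 0} {c ∈ S | c.a 0 < 0}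

/-- Each eliminated constraint is itself a positive combination of members of `S` whose first
coefficients cancel. -/
theorem Derives.of_eliminateAll {n : ℕ} {S : Set (RatConstraint (n + 1))} {a : Fin n → ℚ} {b : ℚ}
    {s : Prop} (h : Derives (eliminateAll S) a b s) : Derives S (Fin.cons 0 a) b s := by
  induction h with
  | @mem c h =>
    rcases h with ⟨c, ⟨hc, h0⟩, rfl⟩ | ⟨c, ⟨hc, hc0⟩, d, ⟨hd, hd0⟩, rfl⟩
    · convert Derives.mem hc using 1
      · ext i
        refine Fin.cases ?_ (fun i => ?_) i
        · simp [h0]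
        · simp [tail]
      · rfl
      · rfl
    · convert ((Derives.mem hc).smul (c.a 0)⁻¹ (inv_pos.2 hc0)).add
        ((Derives.mem hd).smul (-d.a 0)⁻¹ (inv_pos.2 (neg_pos.2 hd0))) using 1
      · ext i
        refine Fin.cases ?_ (fun i => ?_) i
        · have := hc0.ne'
          have := hd0.ne
          simp only [Fin.cons_zero, Pi.add_apply, Pi.smul_apply, smul_eq_mul]
          field_simp
          norm_num
        · simp [eliminate]
      · rfl
      · rfl
  | add _ _ h h' =>
    convert h.add h' using 1
    ext i
    refine Fin.cases ?_ (fun i => ?_) i <;> simp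
  | smul r hr _ h =>
    convert h.smul r hr using 1
    ext i
    refine Fin.cases ?_ (fun i => ?_) i <;> simp

/-- A solution of the system without the first variable extends to the whole system. -/
theorem exists_sat_of_eliminateAll {n : ℕ} {S : Set (RatConstraint (n + 1))} (hS : S.Finite)
    {x : Fin n → ℚ} (hx : ∀ c ∈ eliminateAll S, c.Sat x) :
    ∃ y : Fin (n + 1) → ℚ, ∀ c ∈ S, c.Sat y := by
  let w (c : RatConstraint (n + 1)) : ℚ := ∑ i : Fin n, c.a i.succ * x i
  let v (c : RatConstraint (n + 1)) : ℚ := (c.b - w c) / c.a 0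
  obtain ⟨t, htL, htU⟩ := exists_between_bounds (hS.subset (sep_subset S fun c => c.a 0 < 0))
    (hS.subset (sep_subset S fun c => 0 < c.a 0)) v strict (by
      rintro d ⟨hd, hd0⟩ c ⟨hc, hc0⟩
      have h := hx _ (.inr ⟨c, ⟨hc, hc0⟩, d, ⟨hd, hd0⟩, rfl⟩)
      have hsum : ∑ i, ((eliminate c d).a i : ℚ) * x i
          = (c.a 0)⁻¹ * w c + (-d.a 0)⁻¹ * w d := by
        simp only [eliminate, w, Finset.mul_sum, ← Finset.sum_add_distrib]
        exact Finset.sum_congr rfl fun i _ => by ring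
      simp only [Sat, Rat.cast_id, hsum] at h
      simp only [eliminate] at h
      -- The eliminated inequality says exactly that the lower bound `v d` does not exceed the upper
      -- bound `v c`.
      have key : v c - v d = ((c.a 0)⁻¹ * c.b + (-d.a 0)⁻¹ * d.b)
          - ((c.a 0)⁻¹ * w c + (-d.a 0)⁻¹ * w d) := by
        simp only [v, div_eq_mul_inv, inv_neg]
        ring
      exact ⟨by linarith [h.1], fun hs => by linarith [h.2 hs.symm]⟩)
  refine ⟨Fin.cons t x, fun c hc => ?_⟩
  have hsum : ∑ i, (c.a i : ℚ) * (Fin.cons t x : Fin (n + 1) → ℚ) i = c.a 0 * t + w c := by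
    simp [Fin.sum_univ_succ, w]
  simp only [Sat, hsum, Rat.cast_id]
  rcases lt_trichotomy (c.a 0) 0 with h0 | h0 | h0
  · have h := htL c ⟨hc, h0⟩
    simp only [v, div_le_iff_of_neg h0, div_lt_iff_of_neg h0] at h
    exact ⟨by linarith [h.1], fun hs => by linarith [h.2 hs]⟩
  · have h := hx _ (.inl ⟨c, ⟨hc, h0⟩, rfl⟩)
    simp only [Sat, tail, Rat.cast_id] at h
    simpa [h0] using h
  · have h := htU c ⟨hc, h0⟩
    simp only [v, le_div_iff₀ h0, lt_div_iff₀ h0] at h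
    exact ⟨by linarith [h.1], fun hs => by linarith [h.2 hs]⟩

/-- Motzkin's transposition theorem over `ℚ`. -/
theorem exists_derives_of_infeasible {n : ℕ} {S : Set (RatConstraint n)} (hS : S.Finite)
    (h : ¬∃ x : Fin n → ℚ, ∀ c ∈ S, c.Sat x) :
    ∃ b s, Derives S 0 b s ∧ b ≤ 0 ∧ (b < 0 ∨ s) := by
  induction n with
  | zero =>
    push Not at h
    obtain ⟨c, hc, hx⟩ := h 0
    have hd := Derives.mem hc
    rw [Subsingleton.elim c.a 0] at hd
    refine ⟨c.b, c.strict, hd, ?_⟩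
    simp only [Sat, Finset.univ_eq_empty, Finset.sum_empty, Rat.cast_id] at hx
    by_contra hcon
    apply hx
    by_cases hb : 0 < c.b
    · exact ⟨hb.le, fun _ => hb⟩
    · have hb0 : c.b ≤ 0 := not_lt.1 hb
      have : ¬(c.b < 0 ∨ c.strict) := fun h' => hcon ⟨hb0, h'⟩
      push Not at this
      exact ⟨this.1, fun hs => (this.2 hs).elim⟩
  | succ n ih =>
    have hfin : (eliminateAll S).Finite :=
      ((hS.subset (sep_subset _ _)).image _).union
        ((hS.subset (sep_subset _ _)).image2 _ (hS.subset (sep_subset _ _)))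
    obtain ⟨b, s, hd, hb⟩ := ih hfin fun ⟨x, hx⟩ => h (exists_sat_of_eliminateAll hS hx)
    refine ⟨b, s, ?_, hb⟩
    convert hd.of_eliminateAll using 1
    ext i
    refine Fin.cases ?_ (fun i => ?_) i <;> simp

theorem Derives.sat {n : ℕ} {S : Set (RatConstraint n)} {a : Fin n → ℚ} {b : ℚ} {s : Prop}
    (h : Derives S a b s) {x : Fin n → ℝ} (hx : ∀ c ∈ S, c.Sat x) :
    (⟨a, b, s⟩ : RatConstraint n).Sat x := by
  induction h with
  | mem h => exact hx _ h
  | add _ _ h h' =>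
    simp only [Sat, Pi.add_apply, Rat.cast_add, add_mul, Finset.sum_add_distrib] at h h' ⊢
    refine ⟨add_le_add h.1 h'.1, ?_⟩
    rintro (hs | hs)
    · exact add_lt_add_of_lt_of_le (h.2 hs) h'.1
    · exact add_lt_add_of_le_of_lt h.1 (h'.2 hs)
  | smul r hr _ h =>
    have hr' : (0 : ℝ) < r := by exact_mod_cast hr
    simp only [Sat, Pi.smul_apply, smul_eq_mul, Rat.cast_mul, mul_assoc, ← Finset.mul_sum] at h ⊢
    exact ⟨mul_le_mul_of_nonneg_left h.1 hr'.le, fun hs => mul_lt_mul_of_pos_left (h.2 hs) hr'⟩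

/-- For a system of weak constraints this forces a certificate `0 ≤ b` with `b < 0`, which can be
made quantitative. -/
theorem Derives.exists_strict {n : ℕ} {S : Set (RatConstraint n)} {a : Fin n → ℚ} {b : ℚ}
    {s : Prop} (h : Derives S a b s) (hs : s) : ∃ c ∈ S, c.strict := by
  induction h with
  | mem h => exact ⟨_, h, hs⟩
  | add _ _ h h' => exact hs.elim h h'
  | smul _ _ _ h => exact h hs

/-- `K` is the sum of the multipliers in the derivation, so relaxing every constraint by `ε` costs
`K * ε`. -/
theorem Derives.exists_relaxed {n : ℕ} {S : Set (RatConstraint n)} {a : Fin n → ℚ} {b : ℚ}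
    {s : Prop} (h : Derives S a b s) :
    ∃ K : ℚ, ∀ (x : Fin n → ℝ) (ε : ℝ),
      (∀ c ∈ S, ∑ i, (c.a i : ℝ) * x i ≤ c.b + ε) → ∑ i, (a i : ℝ) * x i ≤ b + K * ε := by
  induction h with
  | mem h => exact ⟨1, fun x ε hx => by simpa using hx _ h⟩
  | add _ _ h h' =>
    obtain ⟨K, h⟩ := h
    obtain ⟨K', h'⟩ := h'
    refine ⟨K + K', fun x ε hx => ?_⟩
    simp only [Pi.add_apply, Rat.cast_add, add_mul, Finset.sum_add_distrib]
    linarith [h x ε hx, h' x ε hx]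
  | smul r hr _ h =>
    obtain ⟨K, h⟩ := h
    refine ⟨r * K, fun x ε hx => ?_⟩
    have hr' : (0 : ℝ) < r := by exact_mod_cast hr
    simp only [Pi.smul_apply, smul_eq_mul, Rat.cast_mul, mul_assoc, ← Finset.mul_sum, ← mul_add]
    exact mul_le_mul_of_nonneg_left (h x ε hx) hr'.le

/-- A finite system of rational linear constraints that has a real solution has a rational one. -/
theorem exists_rat_sat {n : ℕ} {S : Set (RatConstraint n)} (hS : S.Finite) {x : Fin n → ℝ}
    (hx : ∀ c ∈ S, c.Sat x) : ∃ y : Fin n → ℚ, ∀ c ∈ S, c.Sat fun i => (y i : ℝ) := by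
  by_cases h : ∃ y : Fin n → ℚ, ∀ c ∈ S, c.Sat y
  · obtain ⟨y, hy⟩ := h
    refine ⟨y, fun c hc => ?_⟩
    have := hy c hc
    simp only [Sat, Rat.cast_id] at this
    simp only [Sat]
    exact_mod_cast this
  -- A rational certificate of infeasibility would also refute the real solution.
  · obtain ⟨b, s, hd, hb, hbs⟩ := exists_derives_of_infeasible hS h
    have := hd.sat hx
    simp only [Sat, Pi.zero_apply, Rat.cast_zero, zero_mul, Finset.sum_const_zero,
      Rat.cast_nonneg, Rat.cast_pos] at this
    rcases hbs with hb' | hs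
    · exact absurd this.1 hb'.not_ge
    · exact absurd (this.2 hs) hb.not_gt

/-- The violation of an infeasible system of weak constraints is bounded away from zero. -/
theorem exists_one_le_mul_of_infeasible {n : ℕ} {S : Set (RatConstraint n)} (hS : S.Finite)
    (hweak : ∀ c ∈ S, ¬c.strict) (h : ¬∃ x : Fin n → ℝ, ∀ c ∈ S, c.Sat x) :
    ∃ K : ℚ, ∀ (x : Fin n → ℝ) (ε : ℝ),
      (∀ c ∈ S, ∑ i, (c.a i : ℝ) * x i ≤ c.b + ε) → 1 ≤ K * ε := by
  obtain ⟨b, s, hd, -, hbs⟩ := exists_derives_of_infeasible hS fun ⟨y, hy⟩ =>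
    h ⟨fun i => y i, fun c hc => by
      have := hy c hc
      simp only [Sat, Rat.cast_id] at this
      simp only [Sat]
      exact_mod_cast this⟩
  have hb : b < 0 := hbs.resolve_right fun hs =>
    let ⟨c, hc, hcs⟩ := hd.exists_strict hs
    hweak c hc hcs
  obtain ⟨K, hKx⟩ := hd.exists_relaxed
  -- The relaxed certificate reads `0 ≤ b + K * ε` with `b < 0`; dividing by `-b` normalises it.
  refine ⟨K / -b, fun x ε hx => ?_⟩
  have := hKx x ε hx
  have hb' : (0 : ℝ) < -b := by exact_mod_cast neg_pos.2 hb
  simp only [Pi.zero_apply, Rat.cast_zero, zero_mul, Finset.sum_const_zero] at this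
  push_cast
  rw [div_mul_eq_mul_div, le_div_iff₀ hb']
  linarith

end RatConstraint

/-! ### Sets determined by finitely many rational half-spaces. -/

/-- The value `a · x - b` of the affine form given by `c = (a, b)`. -/
noncomputable def slack {n : ℕ} (c : (Fin n → ℚ) × ℚ) (x : Fin n → ℝ) : ℝ :=
  ∑ i, (c.1 i : ℝ) * x i - c.2

theorem slack_neg {n : ℕ} (c : (Fin n → ℚ) × ℚ) (x : Fin n → ℝ) : slack (-c) x = -slack c x := by
  simp [slack, add_comm, sub_eq_add_neg]

theorem slack_lineMap {n : ℕ} (c : (Fin n → ℚ) × ℚ) (x y : Fin n → ℝ) (t : ℝ) :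
    slack c (AffineMap.lineMap x y t) = (1 - t) * slack c x + t * slack c y := by
  have h : ∑ i, (c.1 i : ℝ) * (AffineMap.lineMap x y t : Fin n → ℝ) i
      = (1 - t) * ∑ i, (c.1 i : ℝ) * x i + t * ∑ i, (c.1 i : ℝ) * y i := by
    rw [Finset.mul_sum, Finset.mul_sum, ← Finset.sum_add_distrib]
    refine Finset.sum_congr rfl fun i _ => ?_
    simp [AffineMap.lineMap_apply]
    ring
  rw [slack, h, slack, slack]
  ring

/-- The set `A` is a union of cells of the hyperplane arrangement `c`. -/
def DeterminedBy {n : ℕ} {ι : Type*} (c : ι → (Fin n → ℚ) × ℚ) (A : Set (Fin n → ℝ)) : Prop :=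
  ∀ x y, (∀ i, slack (c i) x ≤ 0 ↔ slack (c i) y ≤ 0) → (x ∈ A ↔ y ∈ A)

/-- The set `A` is determined by finitely many rational half-spaces. -/
def FinitelyDetermined {n : ℕ} (A : Set (Fin n → ℝ)) : Prop :=
  ∃ F : Finset ((Fin n → ℚ) × ℚ), DeterminedBy (fun c : F => c.1) A

theorem DeterminedBy.mono {n : ℕ} {F G : Finset ((Fin n → ℚ) × ℚ)} {A : Set (Fin n → ℝ)}
    (h : DeterminedBy (fun c : F => c.1) A) (hFG : F ⊆ G) : DeterminedBy (fun c : G => c.1) A :=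
  fun x y hxy => h x y fun c => hxy ⟨c.1, hFG c.2⟩

/-- Finitely many finitely determined sets are determined by common half-spaces. -/
theorem exists_common_determinedBy {n : ℕ} {κ : Type*} [Finite κ] {A : κ → Set (Fin n → ℝ)}
    (h : ∀ k, FinitelyDetermined (A k)) :
    ∃ F : Finset ((Fin n → ℚ) × ℚ), ∀ k, DeterminedBy (fun c : F => c.1) (A k) := by
  classical
  cases nonempty_fintype κ
  choose F hF using h
  exact ⟨Finset.univ.biUnion F, fun k =>
    (hF k).mono (Finset.subset_biUnion_of_mem F (Finset.mem_univ k))⟩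

theorem FinitelyDetermined.of_finite {n : ℕ} {κ : Type*} [Finite κ] {A : κ → Set (Fin n → ℝ)}
    (h : ∀ k, FinitelyDetermined (A k)) {B : Set (Fin n → ℝ)}
    (hB : ∀ x y, (∀ k, x ∈ A k ↔ y ∈ A k) → (x ∈ B ↔ y ∈ B)) : FinitelyDetermined B :=
  let ⟨F, hF⟩ := exists_common_determinedBy h
  ⟨F, fun x y hxy => hB x y fun k => hF k x y hxy⟩

theorem finitelyDetermined_of_mem_closure {n : ℕ} {T : Set (Set (Fin n → ℝ))}
    (hT : ∀ A ∈ T, FinitelyDetermined A) {A : Set (Fin n → ℝ)}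
    (hA : A ∈ BooleanSubalgebra.closure T) : FinitelyDetermined A := by
  induction hA using BooleanSubalgebra.closure_bot_sup_induction with
  | mem A hA => exact hT A hA
  | bot => exact ⟨∅, fun _ _ _ => Iff.rfl⟩
  | sup A _ B _ hA hB =>
    refine FinitelyDetermined.of_finite (A := fun b : Bool => if b then A else B)
      (by rintro (_ | _) <;> simpa) fun x y h => ?_
    have h1 := h true
    have h2 := h false
    simp only [if_true, Bool.false_eq_true, if_false] at h1 h2
    exact or_congr h1 h2
  | compl A _ hA =>
    exact .of_finite (A := fun _ : Unit => A) (fun _ => hA) fun x y h => not_congr (h ())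

theorem finitelyDetermined_le {n : ℕ} (a : Fin n → ℚ) (b : ℚ) :
    FinitelyDetermined {x : Fin n → ℝ | ∑ i, (a i : ℝ) * x i ≤ b} :=
  ⟨{(a, b)}, fun x y h => by simpa [slack] using h ⟨(a, b), by simp⟩⟩

theorem IsHalfSpaceCombination.finitelyDetermined {n : ℕ} {A : Set (Fin n → ℝ)}
    (hA : IsHalfSpaceCombination A) : FinitelyDetermined A := by
  refine finitelyDetermined_of_mem_closure ?_ hA
  rintro _ ⟨a, b, -, rfl⟩
  exact finitelyDetermined_le a b

theorem finitelyDetermined_coord_le {n : ℕ} (i : Fin n) (b : ℚ) :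
    FinitelyDetermined {x : Fin n → ℝ | x i ≤ b} := by
  convert finitelyDetermined_le (Pi.single i 1) b using 4 with x
  simp [Pi.single_apply, apply_ite (Rat.cast : ℚ → ℝ)]

theorem finitelyDetermined_le_coord {n : ℕ} (i : Fin n) (b : ℚ) :
    FinitelyDetermined {x : Fin n → ℝ | (b : ℝ) ≤ x i} := by
  convert finitelyDetermined_le (Pi.single i (-1)) (-b) using 3 with x
  simp [Pi.single_apply, apply_ite (Rat.cast : ℚ → ℝ)]

theorem finitelyDetermined_coord {n : ℕ} (i : Fin n) {I : Set ℝ} (hI : IsRatInterval I) :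
    FinitelyDetermined {x : Fin n → ℝ | x i ∈ I} := by
  have key (a b : ℚ) : ∀ k : Bool × Bool, FinitelyDetermined
      (match k with
        | (false, false) => {x : Fin n → ℝ | x i ≤ a}
        | (false, true) => {x : Fin n → ℝ | (a : ℝ) ≤ x i}
        | (true, false) => {x : Fin n → ℝ | x i ≤ b}
        | (true, true) => {x : Fin n → ℝ | (b : ℝ) ≤ x i}) := by
    rintro ⟨_ | _, _ | _⟩
    · exact finitelyDetermined_coord_le i a
    · exact finitelyDetermined_le_coord i a
    · exact finitelyDetermined_coord_le i b
    · exact finitelyDetermined_le_coord i b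
  -- Membership in `I` depends only on comparisons with its endpoints; rays repeat their single
  -- endpoint.
  obtain ⟨a, b, hab⟩ : ∃ a b : ℚ, ∀ t u : ℝ, (t ≤ a ↔ u ≤ a) → (a ≤ t ↔ a ≤ u) →
      (t ≤ b ↔ u ≤ b) → (b ≤ t ↔ b ≤ u) → (t ∈ I ↔ u ∈ I) := by
    cases hI with
    | icc a b => exact ⟨a, b, fun t u h1 h2 h3 h4 => and_congr h2 h3⟩
    | ico a b => exact ⟨a, b, fun t u h1 h2 h3 h4 => and_congr h2 (by simpa using not_congr h4)⟩
    | ioc a b => exact ⟨a, b, fun t u h1 h2 h3 h4 => and_congr (by simpa using not_congr h1) h3⟩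
    | ioo a b => exact ⟨a, b, fun t u h1 h2 h3 h4 =>
        and_congr (by simpa using not_congr h1) (by simpa using not_congr h4)⟩
    | ici a => exact ⟨a, a, fun t u h1 h2 h3 h4 => h2⟩
    | ioi a => exact ⟨a, a, fun t u h1 h2 h3 h4 => by simpa using not_congr h1⟩
    | iic b => exact ⟨b, b, fun t u h1 h2 h3 h4 => h1⟩
    | iio b => exact ⟨b, b, fun t u h1 h2 h3 h4 => by simpa using not_congr h2⟩
    | univ => exact ⟨0, 0, fun t u h1 h2 h3 h4 => Iff.rfl⟩
  exact .of_finite (key a b) fun x y h => hab (x i) (y i) (h (false, false)) (h (false, true))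
    (h (true, false)) (h (true, true))

theorem IsParaxialCombination.finitelyDetermined {n : ℕ} {A : Set (Fin n → ℝ)}
    (hA : IsParaxialCombination A) : FinitelyDetermined A := by
  refine finitelyDetermined_of_mem_closure ?_ hA
  rintro _ ⟨i, I, hI, rfl⟩
  exact finitelyDetermined_coord i hI

theorem Rule.finitelyDetermined {n m : ℕ} {s : Rule n m}
    (hs : s.IsPropositional ∨ s.IsMofN ∨ s.IsOblique) :
    FinitelyDetermined s.cond ∧ FinitelyDetermined s.concl := by
  rcases hs with hs | ⟨⟨t, r, A, hA, hcond⟩, hs⟩ | hs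
  · exact ⟨hs.1.finitelyDetermined, hs.2.finitelyDetermined⟩
  · refine ⟨.of_finite (fun k => (hA k).finitelyDetermined) fun x y h => ?_, hs.finitelyDetermined⟩
    rcases hcond with hc | hc | hc <;> simp only [hc, mem_ofPred_eq, h]
  · exact ⟨hs.1.finitelyDetermined, hs.2.finitelyDetermined⟩

/-! ### Cells and their violation functions. -/

/-- The affine form `c` or its negative. -/
def signed {n : ℕ} (s : Bool) (c : (Fin n → ℚ) × ℚ) : (Fin n → ℚ) × ℚ :=
  if s then c else -c

/-- The weak inequalities with the sign pattern `σ`. -/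
def weakCell {n : ℕ} {ι : Type*} (c : ι → (Fin n → ℚ) × ℚ) (σ : ι → Bool) : Set (Fin n → ℝ) :=
  {x | ∀ i, slack (signed (σ i) (c i)) x ≤ 0}

/-- The sign pattern of the point `x`. -/
noncomputable def pattern {n : ℕ} {ι : Type*} (c : ι → (Fin n → ℚ) × ℚ) (x : Fin n → ℝ) :
    ι → Bool :=
  fun i => decide (slack (c i) x ≤ 0)

/-- The total violation of the inequalities that define `weakCell c σ`. -/
noncomputable def violation {n : ℕ} {ι : Type*} [Fintype ι] (c : ι → (Fin n → ℚ) × ℚ)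
    (σ : ι → Bool) (x : Fin n → ℝ) : ℝ :=
  ∑ i, relu (slack (signed (σ i) (c i)) x)

section cells

variable {n : ℕ} {ι : Type*} {c : ι → (Fin n → ℚ) × ℚ}

theorem mem_weakCell_pattern (c : ι → (Fin n → ℚ) × ℚ) (x : Fin n → ℝ) :
    x ∈ weakCell c (pattern c x) := by
  intro i
  by_cases h : slack (c i) x ≤ 0
  · simp [pattern, signed, h]
  · simpa [pattern, signed, h, slack_neg] using (not_le.1 h).le

theorem violation_nonneg [Fintype ι] (σ : ι → Bool) (x : Fin n → ℝ) : 0 ≤ violation c σ x :=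
  Finset.sum_nonneg fun _ _ => le_max_left _ _

theorem violation_eq_zero [Fintype ι] {σ : ι → Bool} {x : Fin n → ℝ} (hx : x ∈ weakCell c σ) :
    violation c σ x = 0 :=
  Finset.sum_eq_zero fun i _ => max_eq_left (hx i)

/-- On the segment from a point `y` of the weak cell to `x`, every point other than `y` has the
pattern of `x`, hence lies in `A`; let it tend to `y`. -/
theorem DeterminedBy.weakCell_subset_closure {A : Set (Fin n → ℝ)} (hA : DeterminedBy c A)
    {x : Fin n → ℝ} (hx : x ∈ A) : weakCell c (pattern c x) ⊆ closure A := by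
  intro y hy
  have hlim : Filter.Tendsto (fun t : ℝ => (AffineMap.lineMap y x t : Fin n → ℝ)) (𝓝[>] 0)
      (𝓝 y) := by
    have h : Continuous fun t : ℝ => (AffineMap.lineMap y x t : Fin n → ℝ) :=
      AffineMap.lineMap_continuous
    simpa using (h.tendsto 0).mono_left nhdsWithin_le_nhds
  refine mem_closure_of_tendsto hlim ?_
  filter_upwards [Ioo_mem_nhdsGT (zero_lt_one' ℝ)] with t ht
  refine (hA _ _ fun i => ?_).1 hx
  rw [slack_lineMap]
  have hyi := hy i
  by_cases h : slack (c i) x ≤ 0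
  · simp only [pattern, signed, h, decide_true, if_true] at hyi
    simp only [h, true_iff]
    nlinarith [ht.1, ht.2]
  · simp only [pattern, signed, h, decide_false, Bool.false_eq_true, if_false, slack_neg] at hyi
    simp only [h, false_iff, not_le]
    have := mul_pos ht.1 (not_le.1 h)
    have := mul_nonneg (sub_nonneg.2 ht.2.le) (neg_nonpos.1 hyi)
    linarith

/-- A nonempty set that is determined by finitely many rational half-spaces has a rational
point. -/
theorem DeterminedBy.exists_rat_mem [Finite ι] {A : Set (Fin n → ℝ)} (hA : DeterminedBy c A)
    (hne : A.Nonempty) : ∃ q : Fin n → ℚ, (fun i => (q i : ℝ)) ∈ A := by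
  obtain ⟨x, hx⟩ := hne
  let k (i : ι) : RatConstraint n :=
    -- The negated inequalities must be strict, so that a solution has exactly the pattern of `x`.
    ⟨(signed (pattern c x i) (c i)).1, (signed (pattern c x i) (c i)).2, ¬slack (c i) x ≤ 0⟩
  have hk (i : ι) (y : Fin n → ℝ) : (k i).Sat y ↔ slack (signed (pattern c x i) (c i)) y ≤ 0 ∧
      (¬slack (c i) x ≤ 0 → slack (signed (pattern c x i) (c i)) y < 0) := by
    simp only [k, RatConstraint.Sat, slack, sub_nonpos, sub_neg]
  obtain ⟨q, hq⟩ := RatConstraint.exists_rat_sat (S := range k) (finite_range k) (x := x) (by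
    rintro _ ⟨i, rfl⟩
    refine (hk i x).2 ⟨mem_weakCell_pattern c x i, fun h => ?_⟩
    simpa [pattern, signed, h, slack_neg] using not_le.1 h)
  refine ⟨q, (hA x _ fun i => ?_).1 hx⟩
  have := (hk i _).1 (hq _ ⟨i, rfl⟩)
  by_cases h : slack (c i) x ≤ 0
  · simpa [pattern, signed, h] using this.1
  · have := this.2 h
    simp only [pattern, signed, h, decide_false, Bool.false_eq_true, if_false, slack_neg,
      neg_lt_zero] at this
    simpa [h] using this

theorem exists_one_le_mul_violation_of_disjoint [Fintype ι] {σ τ : ι → Bool}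
    (h : Disjoint (weakCell c σ) (weakCell c τ)) :
    ∃ K : ℚ, ∀ x ∈ weakCell c τ, 1 ≤ K * violation c σ x := by
  let k (ρ : ι → Bool) (i : ι) : RatConstraint n :=
    ⟨(signed (ρ i) (c i)).1, (signed (ρ i) (c i)).2, False⟩
  obtain ⟨K, hK⟩ := RatConstraint.exists_one_le_mul_of_infeasible
    (S := range (k σ) ∪ range (k τ)) ((finite_range _).union (finite_range _))
    (by rintro _ (⟨i, rfl⟩ | ⟨i, rfl⟩) <;> exact id) (by
      rintro ⟨x, hx⟩
      have h' : x ∈ weakCell c σ → x ∉ weakCell c τ := fun hσ => disjoint_left.1 h hσ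
      refine h' (fun i => ?_) fun i => ?_
      · exact sub_nonpos.2 (hx _ (.inl ⟨i, rfl⟩)).1
      · exact sub_nonpos.2 (hx _ (.inr ⟨i, rfl⟩)).1)
  -- Take `ε` to be the total violation: it bounds each violation of `σ`, while the inequalities of
  -- `τ` hold outright.
  refine ⟨K, fun x hx => hK x _ ?_⟩
  rintro _ (⟨i, rfl⟩ | ⟨i, rfl⟩)
  · rw [← sub_le_iff_le_add']
    exact (le_max_right 0 _).trans (Finset.single_le_sum (f := fun i =>
      relu (slack (signed (σ i) (c i)) x)) (fun _ _ => le_max_left _ _) (Finset.mem_univ i))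
  · exact (sub_nonpos.1 (hx i)).trans (le_add_of_nonneg_right (violation_nonneg σ x))

/-- A constant `K` that works for all pairs of disjoint cells. -/
theorem exists_one_le_mul_violation [Fintype ι] (c : ι → (Fin n → ℚ) × ℚ) :
    ∃ K : ℚ, ∀ σ τ : ι → Bool, Disjoint (weakCell c σ) (weakCell c τ) →
      ∀ x ∈ weakCell c τ, 1 ≤ K * violation c σ x := by
  have h (p : (ι → Bool) × (ι → Bool)) : ∃ K : ℚ, Disjoint (weakCell c p.1) (weakCell c p.2) →
      ∀ x ∈ weakCell c p.2, 1 ≤ K * violation c p.1 x := by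
    by_cases hd : Disjoint (weakCell c p.1) (weakCell c p.2)
    · obtain ⟨K, hK⟩ := exists_one_le_mul_violation_of_disjoint hd
      exact ⟨K, fun _ => hK⟩
    · exact ⟨0, fun h => (hd h).elim⟩
  choose K hK using h
  obtain ⟨M, hM⟩ := Finite.exists_le K
  exact ⟨M, fun σ τ hd x hx => (hK (σ, τ) hd x hx).trans
    (mul_le_mul_of_nonneg_right (by exact_mod_cast hM (σ, τ)) (violation_nonneg σ x))⟩

end cells

/-! ### Building the network. -/

/-- The function `f` is computed by a ReLU network, for any enumeration of its outputs. -/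
def IsReLUComputable {n : ℕ} {κ : Type*} (f : (Fin n → ℝ) → κ → ℝ) : Prop :=
  ∀ (k : ℕ) (e : Fin k ≃ κ), ∃ N : FeedforwardNet n k, N.IsReLU ∧ ∀ x i, N.eval x i = f x (e i)

theorem isReLUComputable_affine {n : ℕ} {κ : Type*} (W : κ → Fin n → ℚ) (b : κ → ℚ) :
    IsReLUComputable fun (x : Fin n → ℝ) i => ∑ j, (W i j : ℝ) * x j + b i :=
  fun _ e => ⟨.output (fun i => W (e i)) (fun i => b (e i)) fun _ => id, fun _ => rfl,
    fun _ _ => rfl⟩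

/-- The linear output layer becomes a hidden layer once its activation is replaced by `relu`. -/
theorem FeedforwardNet.exists_append {n k m : ℕ} (N : FeedforwardNet n k) (hN : N.IsReLU)
    (W : Matrix (Fin m) (Fin k) ℚ) (b : Fin m → ℚ) :
    ∃ N' : FeedforwardNet n m, N'.IsReLU ∧
      ∀ x i, N'.eval x i = ∑ j, (W i j : ℝ) * relu (N.eval x j) + b i := by
  induction N with
  | output W₀ b₀ σ =>
    refine ⟨.hidden W₀ b₀ (fun _ => relu) (.output W b fun _ => id),
      ⟨fun _ => rfl, fun _ => rfl⟩, fun x i => ?_⟩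
    simp [FeedforwardNet.eval, layerOutput, hN _]
  | hidden W₀ b₀ σ N ih =>
    obtain ⟨N', hN', h⟩ := ih hN.2 W
    exact ⟨.hidden W₀ b₀ σ N', ⟨hN.1, hN'⟩, fun x i => h _ i⟩

theorem IsReLUComputable.append {n : ℕ} {κ μ : Type*} [Fintype κ] {f : (Fin n → ℝ) → κ → ℝ}
    (hf : IsReLUComputable f) (W : μ → κ → ℚ) (b : μ → ℚ) :
    IsReLUComputable fun x i => ∑ j, (W i j : ℝ) * relu (f x j) + b i := by
  intro k e
  let e' := (Fintype.equivFin κ).symm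
  obtain ⟨N, hN, h⟩ := hf _ e'
  obtain ⟨N', hN', h'⟩ := N.exists_append hN (fun i j => W (e i) (e' j)) fun i => b (e i)
  refine ⟨N', hN', fun x i => ?_⟩
  simp only [h', h]
  rw [e'.sum_comp fun j => (W (e i) j : ℝ) * relu (f x j)]

theorem SeparatedByClosedNhds.disjoint_closure {X : Type*} [TopologicalSpace X] {A B : Set X}
    (h : SeparatedByClosedNhds A B) : Disjoint (closure A) (closure B) := by
  obtain ⟨U, V, hU, hV, hAU, hBV, hd⟩ := h
  exact hd.mono (closure_minimal (subset_of_mem_nhdsSet hAU) hU)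
    (closure_minimal (subset_of_mem_nhdsSet hBV) hV)

theorem isReLUComputable_violation {n : ℕ} {ι : Type*} [Fintype ι] (c : ι → (Fin n → ℚ) × ℚ)
    (K : ℚ) : IsReLUComputable fun x (σ : ι → Bool) => 1 - (K : ℝ) * violation c σ x := by
  -- The hidden nodes carry both signs of every form; the weights of the next layer select the sign
  -- prescribed by `σ`.
  have h := (isReLUComputable_affine (fun p : ι × Bool => (signed p.2 (c p.1)).1)
    fun p => -(signed p.2 (c p.1)).2).append
      (fun (σ : ι → Bool) p => if σ p.1 = p.2 then -K else 0) fun _ => 1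
  convert h using 3 with x σ
  have h' (p : ι × Bool) : ∑ j, ((signed p.2 (c p.1)).1 j : ℝ) * x j
      + ((-(signed p.2 (c p.1)).2 : ℚ) : ℝ) = slack (signed p.2 (c p.1)) x := by
    simp [slack, sub_eq_add_neg]
  simp only [h', Fintype.sum_prod_type, violation, Finset.mul_sum]
  rw [Rat.cast_one, sub_eq_neg_add, ← Finset.sum_neg_distrib]
  congr 1
  refine Finset.sum_congr rfl fun i _ => ?_
  simp [apply_ite (Rat.cast : ℚ → ℝ), ite_mul]

/-- Disjoint closures of finitely many sets, each a union of cells, are separated by a ReLU network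
that takes prescribed rational values on these sets. -/
theorem exists_isReLU_eval_eq {n m : ℕ} {ι κ : Type*} [Finite ι] [Finite κ]
    {c : ι → (Fin n → ℚ) × ℚ} {A : κ → Set (Fin n → ℝ)} (hA : ∀ k, DeterminedBy c (A k))
    (hd : Pairwise fun k l => Disjoint (closure (A k)) (closure (A l))) (q : κ → Fin m → ℚ) :
    ∃ N : FeedforwardNet n m, N.IsReLU ∧ ∀ k, ∀ x ∈ A k, N.eval x = fun i => (q k i : ℝ) := by
  classical
  cases nonempty_fintype ι
  cases nonempty_fintype κ
  obtain ⟨K, hK⟩ := exists_one_le_mul_violation c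
  -- Node `k` is `relu (1 - sum of bumps)`, so it is 0 on `A k` and 1 on the other sets. The output
  -- `∑ k, q k * (1 - node k)` is then `q k` on `A k`.
  obtain ⟨N, hN, h⟩ := (((isReLUComputable_violation c K).append
    (fun (k : κ) σ => if ∃ x ∈ A k, pattern c x = σ then -1 else 0) fun _ => 1).append
      (fun (i : Fin m) k => -q k i) fun i => ∑ k, q k i) m (Equiv.refl _)
  refine ⟨N, hN, fun k x hx => funext fun i => ?_⟩
  simp only [h, Equiv.refl_apply]
  have hself : relu (∑ σ, ((if ∃ x ∈ A k, pattern c x = σ then -1 else 0 : ℚ) : ℝ)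
      * relu (1 - K * violation c σ x) + (1 : ℚ)) = 0 := by
    have hterm (σ : ι → Bool) : ((if ∃ x ∈ A k, pattern c x = σ then -1 else 0 : ℚ) : ℝ)
        * relu (1 - K * violation c σ x) ≤ 0 := by
      have : 0 ≤ relu (1 - K * violation c σ x) := le_max_left _ _
      split_ifs <;> simp [this]
    refine max_eq_left ?_
    -- The bump of the cell of `x` alone contributes `-1`; overlapping weak cells only lower the
    -- sum, and `relu` clamps it.
    rw [← Finset.add_sum_erase _ _ (Finset.mem_univ (pattern c x)), if_pos ⟨x, hx, rfl⟩,
      violation_eq_zero (mem_weakCell_pattern c x), mul_zero, sub_zero,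
      show relu 1 = 1 from max_eq_right zero_le_one]
    have hle := Finset.sum_nonpos fun σ (_ : σ ∈ Finset.univ.erase (pattern c x)) => hterm σ
    push_cast at hle ⊢
    linarith
  have hother (l : κ) (hl : l ≠ k) : relu (∑ σ, ((if ∃ x ∈ A l, pattern c x = σ then -1 else 0 : ℚ)
      : ℝ) * relu (1 - K * violation c σ x) + (1 : ℚ)) = 1 := by
    rw [Finset.sum_eq_zero, zero_add, Rat.cast_one]
    · exact max_eq_right zero_le_one
    intro σ _
    split_ifs with hσ
    · obtain ⟨y, hy, rfl⟩ := hσ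
      have := hK _ _ ((hd hl).mono ((hA l).weakCell_subset_closure hy)
        ((hA k).weakCell_subset_closure hx)) x (mem_weakCell_pattern c x)
      rw [show relu (1 - K * violation c (pattern c y) x) = 0 from max_eq_left (by linarith),
        mul_zero]
    · simp
  rw [Rat.cast_sum, ← Finset.sum_add_distrib, Finset.sum_eq_single k]
  · rw [hself]
    simp
  · intro l _ hl
    rw [hother l hl]
    simp
  · simp

theorem mainTheorem6 (n m : ℕ) (S : Set (Rule n m)) (hfin : S.Finite)
    (hS : ∀ s ∈ S, s.IsPropositional ∨ s.IsMofN ∨ s.IsOblique)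
    (hsep : S.Pairwise fun s t => SeparatedByClosedNhds s.cond t.cond)
    (hconcl : ∀ s ∈ S, s.concl ≠ ∅) :
    ∃ N : FeedforwardNet n m, N.IsReLU ∧ ∀ s ∈ S, N.Obeys s := by
  have : Finite S := hfin
  obtain ⟨F, hF⟩ := exists_common_determinedBy fun s : S => (Rule.finitelyDetermined (hS s s.2)).1
  have hrat (s : S) : ∃ q : Fin m → ℚ, (fun i => (q i : ℝ)) ∈ s.1.concl := by
    obtain ⟨G, hG⟩ := (Rule.finitelyDetermined (hS s s.2)).2
    exact hG.exists_rat_mem (nonempty_iff_ne_empty.2 (hconcl s s.2))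
  choose q hq using hrat
  obtain ⟨N, hN, h⟩ := exists_isReLU_eval_eq hF (fun s t hst =>
    (hsep s.2 t.2 (Subtype.coe_injective.ne hst)).disjoint_closure) q
  exact ⟨N, hN, fun s hs x hx => by rw [h ⟨s, hs⟩ x hx]; exact hq ⟨s, hs⟩⟩
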